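/- Let $X$ be a random variable with values in an arbitrary measurable space (continuous or discrete), and let $Y$ be a random variable with a finite set of outcomes $\mathcal Y$. Let $\tilde p_{XY}$ be a joint distribution of $X$ and $Y$ under which $Y=f(X)$ almost surely for some (measurable) function $f$. Let $p_{XY}$ be a joint distribution of $X$ and $Y$ which has the same marginal over $X$ as $\tilde p_{XY}$ and satisfies $|p_{XY}-\tilde p_{XY}|_1\le\epsilon\le\frac12$, where $|p-\tilde p|_1=\int|dp-d\tilde p|$ is the $\ell_1$ distance (the total mass of the variation of the signed measure $p-\tilde p$, without a factor $\frac12$). A bottleneck variable $T$ is a variable with values in some measurable space, given by a stochastic map (Markov kernel) $q(t\mid x)$, so that the Markov condition $Y-X-T$ holds; $I_p(X;T)$ and $I_p(Y;T)$ are the mutual informations under the resulting joint distribution, and $H(p(Y))$ is the Shannon entropy of the $Y$-marginal of $p_{XY}$ (all logarithms are natural, and $0\log 0=0$). Then for any $\beta\in(0,1)$ and any bottleneck variable $T$ which maximizes the IB Lagrangian $I_p(Y;T)-\beta I_p(X;T)$ over all bottleneck variables, $$-\frac{\gamma}{1-\beta}\le I_p(X;T)-H(p(Y))\le\frac{\gamma}{\beta},\qquad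 -\frac{\gamma}{1-\beta}\le I_p(Y;T)-H(p(Y))\le 0,$$ where $\gamma:=-3\epsilon\log\epsilon+5\epsilon\log|\mathcal Y|$. -/

import Mathlib

open MeasureTheory ProbabilityTheory InformationTheory
open scoped ENNReal

namespace InfoBottleneck

universe u

/-- Mutual information (in nats, possibly infinite) of a pair of variables with joint law `μ`:
the Kullback-Leibler divergence of `μ` from the product of its marginals. -/
noncomputable def mutualInfo {A B : Type*} [MeasurableSpace A] [MeasurableSpace B]
    (μ : Measure (A × B)) : ℝ≥0∞ :=
  klDiv μ (μ.fst.prod μ.snd)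

/-- Shannon entropy (in nats) of a law on a finite set of outcomes. -/
noncomputable def entropy {Y : Type*} [Fintype Y] [MeasurableSpace Y] (μ : Measure Y) : ℝ :=
  ∑ y, Real.negMulLog (μ.real {y})

/-- The `ℓ¹` distance `|μ - ν|₁ = ∫ |dμ - dν|` between two finite measures, that is, the total
mass of the variation of the signed measure `μ - ν` (no factor `1 / 2`). -/
noncomputable def l1Dist {A : Type*} [MeasurableSpace A] (μ ν : Measure A)
    [IsFiniteMeasure μ] [IsFiniteMeasure ν] : ℝ :=
  (μ.toSignedMeasure - ν.toSignedMeasure).totalVariation.real Set.univ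

section Bottleneck

variable {X Y T : Type*} [MeasurableSpace X] [MeasurableSpace Y] [MeasurableSpace T]

/-- The law of `((X, Y), T)` when `(X, Y)` has law `p` and, given `(X, Y) = (x, y)`, the bottleneck
variable `T` has law `q x`. This encodes the Markov condition `Y - X - T`. -/
noncomputable def jointXYT (p : Measure (X × Y)) (q : Kernel X T) : Measure ((X × Y) × T) :=
  p ⊗ₘ (q.comap Prod.fst measurable_fst)

/-- `I_p(X;T)` for the bottleneck variable `T` given by the stochastic map `q`. -/
noncomputable def infoX (p : Measure (X × Y)) (q : Kernel X T) : ℝ≥0∞ :=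
  mutualInfo ((jointXYT p q).map (fun z => (z.1.1, z.2)))

/-- `I_p(Y;T)` for the bottleneck variable `T` given by the stochastic map `q`. -/
noncomputable def infoY (p : Measure (X × Y)) (q : Kernel X T) : ℝ≥0∞ :=
  mutualInfo ((jointXYT p q).map (fun z => (z.1.2, z.2)))

/-- The IB Lagrangian `I_p(Y;T) - β I_p(X;T)`. It is extended-real valued because `I_p(X;T)` may
be infinite; for finite `Y` the first term is finite, so no form `∞ - ∞` occurs. -/
noncomputable def lagrangian (p : Measure (X × Y)) (β : ℝ) (q : Kernel X T) : EReal :=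
  (infoY p q : EReal) - (β : EReal) * (infoX p q : EReal)

end Bottleneck

/-- The bottleneck variable given by `q` maximizes the IB Lagrangian of `p` among all
bottleneck variables, with values in arbitrary measurable spaces. -/
def IsLagrangianMaximizer {X Y : Type*} {T : Type u} [MeasurableSpace X] [MeasurableSpace Y]
    [MeasurableSpace T] (p : Measure (X × Y)) (β : ℝ) (q : Kernel X T) : Prop :=
  ∀ (T' : Type u) [MeasurableSpace T'] (q' : Kernel X T') [IsMarkovKernel q'],
    lagrangian p β q' ≤ lagrangian p β q

/-- `γ = -3 ε log ε + 5 ε log n`, where `n` is the number of outcomes of `Y`. -/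
noncomputable def gammaBound (ε : ℝ) (n : ℕ) : ℝ :=
  -3 * ε * Real.log ε + 5 * ε * Real.log n

end InfoBottleneck

/-!
The proof compares the optimal bottleneck variable with the particular choice `T' = f(X)`.

For every bottleneck variable, data processing gives `I(Y;T) ≤ I(X;T)` and `I(Y;T) ≤ H(Y)`
(`infoY_le_infoX`, `infoY_le_entropy`). For `T' = f(X)` one has `I(X;T') ≤ H(T')` and
`I(Y;T') = H(Y) + H(T') - H(Y,T')`, so that its Lagrangian is at least
`(1 - β) H(Y) - β H(T' | Y) - (1 - β) H(Y | T')`. The law `p'` gives no mass to `{Y ≠ f(X)}`, hence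
`p` gives it mass at most `ε`, and a Fano-type inequality (`sum_negMulLog_sub_le`) bounds both
conditional entropies by `ε log |𝒴| - ε log ε + ε`, which is at most `γ` because `ε ≤ 1 / 2`.
The Lagrangian of a maximizer is therefore at least `(1 - β) H(Y) - γ`
(`le_lagrangian_deterministic`), and the four bounds follow by combining this with the two data
processing inequalities. In particular `I(X;T)` is finite for a maximizer, since otherwise its
Lagrangian would be `-∞`.

The bound `I(A;B) ≤ H(A)` for finite `A` and arbitrary `B` is itself a case of data processing:
`B` is obtained from `A` through a Markov kernel, so `I(A;B) ≤ I(A;A) = H(A)`.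
-/

namespace InfoBottleneck

/-! ### Data processing for mutual information -/

section DPI
variable {A B C D : Type*} [MeasurableSpace A] [MeasurableSpace B]
  [MeasurableSpace C] [MeasurableSpace D]

/-- Data processing: applying Markov kernels separately to the two variables does not increase their
mutual information. The kernel `κ ∥ₖ η` sends the joint law and the product of the marginals to the
corresponding laws of the new pair. -/
theorem mutualInfo_parallelComp_le (μ : Measure (A × B)) [IsFiniteMeasure μ]
    (κ : Kernel A C) [IsMarkovKernel κ] (η : Kernel B D) [IsMarkovKernel η] :
    mutualInfo ((κ ∥ₖ η) ∘ₘ μ) ≤ mutualInfo μ := by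
  have hfst : ((κ ∥ₖ η) ∘ₘ μ).fst = κ ∘ₘ μ.fst := by
    ext s hs
    rw [Measure.fst_apply hs, Measure.bind_apply (measurable_fst hs) (Kernel.aemeasurable _),
      Measure.bind_apply hs (Kernel.aemeasurable _), Measure.fst,
      lintegral_map (κ.measurable_coe hs) measurable_fst]
    refine lintegral_congr fun z => ?_
    rw [← Set.prod_univ, Kernel.parallelComp_apply_prod]
    simp
  have hsnd : ((κ ∥ₖ η) ∘ₘ μ).snd = η ∘ₘ μ.snd := by
    ext s hs
    rw [Measure.snd_apply hs, Measure.bind_apply (measurable_snd hs) (Kernel.aemeasurable _),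
      Measure.bind_apply hs (Kernel.aemeasurable _), Measure.snd,
      lintegral_map (η.measurable_coe hs) measurable_snd]
    refine lintegral_congr fun z => ?_
    rw [← Set.univ_prod, Kernel.parallelComp_apply_prod]
    simp
  have hprod : (κ ∘ₘ μ.fst).prod (η ∘ₘ μ.snd) = (κ ∥ₖ η) ∘ₘ (μ.fst.prod μ.snd) := by
    rw [Measure.prod_comp_right, Measure.prod_comp_left, Measure.comp_assoc,
      Kernel.id_parallelComp_comp_parallelComp_id]
  rw [mutualInfo, hfst, hsnd, hprod]
  exact klDiv_comp_right_le _ _ _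

theorem mutualInfo_map_swap_le (μ : Measure (A × B)) [IsFiniteMeasure μ] :
    mutualInfo (μ.map Prod.swap) ≤ mutualInfo μ := by
  have h : (μ.map Prod.swap).fst.prod (μ.map Prod.swap).snd
      = (μ.fst.prod μ.snd).map Prod.swap := by
    rw [Measure.fst_map_swap, Measure.snd_map_swap, Measure.prod_swap]
  rw [mutualInfo, h]
  exact klDiv_map_le _ _ measurable_swap

/-- Disintegration of a joint law along a variable with finitely many outcomes. Unlike
`Measure.condKernel`, this makes no assumption on the space of the other variable. -/
theorem exists_markovKernel_compProd_eq [Fintype A] [MeasurableSingletonClass A]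
    (μ : Measure (A × B)) [IsProbabilityMeasure μ] :
    ∃ κ : Kernel A B, IsMarkovKernel κ ∧ μ.fst ⊗ₘ κ = μ := by
  classical
  -- on outcomes of mass zero any probability measure on `B` will do
  let κ : Kernel A B := Kernel.ofFunOfCountable fun a =>
    if μ.fst {a} = 0 then μ.snd else (cond μ (Prod.fst ⁻¹' {a})).snd
  have hm (a : A) : MeasurableSet (Prod.fst ⁻¹' {a} : Set (A × B)) :=
    measurable_fst (measurableSet_singleton a)
  have hκ (a : A) : κ a = if μ.fst {a} = 0 then μ.snd else (cond μ (Prod.fst ⁻¹' {a})).snd := rfl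
  have : IsMarkovKernel κ := by
    refine ⟨fun a => ?_⟩
    rw [hκ]
    split_ifs with h
    · infer_instance
    · rw [Measure.fst_apply (measurableSet_singleton a)] at h
      have := cond_isProbabilityMeasure h
      infer_instance
  refine ⟨κ, this, ?_⟩
  ext s hs
  rw [Measure.compProd_apply hs, lintegral_fintype]
  have hpart : μ s = ∑ a, μ (Prod.fst ⁻¹' {a} ∩ s) := by
    rw [← measure_biUnion_finset]
    · congr 1; ext z; simp
    · intro a _ b _ hab
      refine Set.disjoint_left.2 fun z hz hz' => hab ?_
      exact hz.1.symm.trans hz'.1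
    · exact fun a _ => (hm a).inter hs
  rw [hpart]
  refine Finset.sum_congr rfl fun a _ => ?_
  rw [hκ]
  have hfa : μ.fst {a} = μ (Prod.fst ⁻¹' {a}) := Measure.fst_apply (measurableSet_singleton a)
  split_ifs with h
  · rw [h, mul_zero, eq_comm]
    exact measure_mono_null Set.inter_subset_left (hfa ▸ h)
  · rw [Measure.snd_apply (measurable_prodMk_left hs), cond_apply (hm a), hfa, mul_comm,
      ← mul_assoc, ENNReal.mul_inv_cancel (hfa ▸ h) (measure_ne_top _ _), one_mul]
    congr 1
    ext ⟨x, y⟩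
    simp only [Set.mem_inter_iff, Set.mem_preimage, Set.mem_singleton_iff]
    constructor <;> rintro ⟨rfl, hxy⟩ <;> exact ⟨rfl, hxy⟩

end DPI

/-! ### Mutual information and entropy of finite variables -/

theorem entropy_nonneg {A : Type*} [Fintype A] [MeasurableSpace A] (μ : Measure A)
    [IsProbabilityMeasure μ] : 0 ≤ entropy μ :=
  Finset.sum_nonneg fun _ _ => Real.negMulLog_nonneg measureReal_nonneg measureReal_le_one

theorem fst_real_singleton {A B : Type*} [MeasurableSpace A] [Fintype B]
    [MeasurableSpace B] [MeasurableSingletonClass A] [MeasurableSingletonClass B]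
    (μ : Measure (A × B)) [IsFiniteMeasure μ] (a : A) :
    μ.fst.real {a} = ∑ b, μ.real {(a, b)} := by
  classical
  rw [measureReal_def, Measure.fst_apply (measurableSet_singleton a), ← measureReal_def,
    ← measureReal_biUnion_finset]
  · congr 1
    ext ⟨x, y⟩
    simp [eq_comm]
  · intro b _ b' _ hb
    simpa [Function.onFun] using hb
  · exact fun b _ => measurableSet_singleton _

theorem snd_real_singleton {A B : Type*} [Fintype A] [MeasurableSpace A]
    [MeasurableSpace B] [MeasurableSingletonClass A] [MeasurableSingletonClass B]
    (μ : Measure (A × B)) [IsFiniteMeasure μ] (b : B) :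
    μ.snd.real {b} = ∑ a, μ.real {(a, b)} := by
  classical
  rw [measureReal_def, Measure.snd_apply (measurableSet_singleton b), ← measureReal_def,
    ← measureReal_biUnion_finset]
  · congr 1
    ext ⟨x, y⟩
    simp [eq_comm]
  · intro a _ a' _ ha
    simpa [Function.onFun] using ha
  · exact fun a _ => measurableSet_singleton _

section Finite
variable {A B : Type*} [Fintype A] [Fintype B] [MeasurableSpace A] [MeasurableSpace B]
  [MeasurableSingletonClass A] [MeasurableSingletonClass B]

/-- The Kullback-Leibler divergence on a finite type as a sum. The terms with `ν {a} = 0` vanish, as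
`μ ≪ ν`. -/
theorem klDiv_eq_ofReal_sum (μ ν : Measure A) [IsProbabilityMeasure μ] [IsProbabilityMeasure ν]
    (h : μ ≪ ν) :
    klDiv μ ν = ENNReal.ofReal (∑ a, μ.real {a} * Real.log (μ.real {a} / ν.real {a})) := by
  rw [klDiv_of_ac_of_integrable h (Integrable.of_finite)]
  congr 1
  rw [integral_fintype (Integrable.of_finite)]
  simp only [probReal_univ, add_sub_cancel_right, smul_eq_mul]
  refine Finset.sum_congr rfl fun a _ => ?_
  by_cases ha : ν {a} = 0
  · simp [measureReal_def, h ha]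
  have hr : μ.rnDeriv ν a * ν {a} = μ {a} := by
    rw [← Measure.setLIntegral_rnDeriv h, lintegral_singleton]
  have : (μ.rnDeriv ν a).toReal = μ.real {a} / ν.real {a} := by
    rw [measureReal_def, ← hr, ENNReal.toReal_mul, measureReal_def, mul_div_cancel_right₀]
    exact (ENNReal.toReal_pos ha (measure_ne_top _ _)).ne'
  rw [llr, this]

/-- `I(A;B) = H(A) + H(B) - H(A,B)` for finite variables. -/
theorem mutualInfo_eq_ofReal_entropy (μ : Measure (A × B)) [IsProbabilityMeasure μ] :
    mutualInfo μ = ENNReal.ofReal (entropy μ.fst + entropy μ.snd - entropy μ) := by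
  have hac : μ ≪ μ.fst.prod μ.snd := by
    intro s hs
    refine (measure_null_iff_singleton s.to_countable).2 fun z hz => ?_
    have h0 := measure_mono_null (Set.singleton_subset_iff.2 hz) hs
    rw [← Prod.mk.eta (p := z), ← Set.singleton_prod_singleton, Measure.prod_prod,
      mul_eq_zero] at h0
    rcases h0 with h0 | h0
    · rw [Measure.fst_apply (measurableSet_singleton _)] at h0
      exact measure_mono_null (by simp) h0
    · rw [Measure.snd_apply (measurableSet_singleton _)] at h0
      exact measure_mono_null (by simp) h0
  rw [mutualInfo, klDiv_eq_ofReal_sum _ _ hac]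
  congr 1
  have hterm (a : A) (b : B) : μ.real {(a, b)} * Real.log (μ.real {(a, b)} /
      (μ.fst.prod μ.snd).real {(a, b)}) = - (μ.real {(a, b)} * Real.log (μ.fst.real {a}))
        - μ.real {(a, b)} * Real.log (μ.snd.real {b}) - Real.negMulLog (μ.real {(a, b)}) := by
    rcases eq_or_ne (μ.real {(a, b)}) 0 with h0 | h0
    · simp [h0]
    have hpos : 0 < μ.real {(a, b)} := lt_of_le_of_ne measureReal_nonneg h0.symm
    have h1 : 0 < μ.fst.real {a} := by
      rw [fst_real_singleton]
      exact hpos.trans_le (Finset.single_le_sum (f := fun b => μ.real {(a, b)})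
        (fun _ _ => measureReal_nonneg) (Finset.mem_univ b))
    have h2 : 0 < μ.snd.real {b} := by
      rw [snd_real_singleton]
      exact hpos.trans_le (Finset.single_le_sum (f := fun a => μ.real {(a, b)})
        (fun _ _ => measureReal_nonneg) (Finset.mem_univ a))
    rw [← Set.singleton_prod_singleton, measureReal_prod_prod, Set.singleton_prod_singleton,
      Real.log_div h0 (by positivity), Real.log_mul h1.ne' h2.ne', Real.negMulLog]
    ring
  rw [Fintype.sum_prod_type]
  simp only [hterm, Finset.sum_sub_distrib, Finset.sum_neg_distrib]
  have e1 : entropy μ.fst = - ∑ a, ∑ b, μ.real {(a, b)} * Real.log (μ.fst.real {a}) := by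
    simp only [entropy, Real.negMulLog, neg_mul, Finset.sum_neg_distrib, ← Finset.sum_mul,
      ← fst_real_singleton]
  have e2 : entropy μ.snd = - ∑ a, ∑ b, μ.real {(a, b)} * Real.log (μ.snd.real {b}) := by
    rw [Finset.sum_comm]
    simp only [entropy, Real.negMulLog, neg_mul, Finset.sum_neg_distrib, ← Finset.sum_mul,
      ← snd_real_singleton]
  rw [e1, e2, entropy, Fintype.sum_prod_type]
  ring

end Finite

/-- `I(A;B) ≤ H(A)` for finite `A` and arbitrary `B`. -/
theorem mutualInfo_le_entropy_fst {A B : Type*} [MeasurableSpace A] [MeasurableSpace B]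
    [Fintype A] [MeasurableSingletonClass A] (μ : Measure (A × B)) [IsProbabilityMeasure μ] :
    mutualInfo μ ≤ ENNReal.ofReal (entropy μ.fst) := by
  obtain ⟨κ, hκ, hμ⟩ := exists_markovKernel_compProd_eq μ
  have hd : Measurable fun a : A => (a, a) := by fun_prop
  have hcopy : Kernel.copy A ∘ₘ μ.fst = μ.fst.map (fun a => (a, a)) := by
    rw [Kernel.copy, Measure.deterministic_comp_eq_map]
    rfl
  have := Measure.isProbabilityMeasure_map (μ := μ.fst) hd.aemeasurable
  have hent : entropy (μ.fst.map fun a => (a, a)) = entropy μ.fst := by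
    rw [entropy, Fintype.sum_prod_type, entropy]
    refine Finset.sum_congr rfl fun a _ => ?_
    rw [Finset.sum_eq_single a]
    · rw [map_measureReal_apply hd (measurableSet_singleton _)]
      congr 2; ext; simp
    · intro b _ hb
      rw [map_measureReal_apply hd (measurableSet_singleton _)]
      have : (fun a : A => (a, a)) ⁻¹' {(a, b)} = ∅ := by
        ext x; simp; rintro rfl h; exact hb h.symm
      simp [this]
    · simp
  calc mutualInfo μ = mutualInfo ((Kernel.id ∥ₖ κ) ∘ₘ (μ.fst.map fun a => (a, a))) := by
        rw [← hcopy, ← Measure.compProd_eq_parallelComp_comp_copy_comp, hμ]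
    _ ≤ mutualInfo (μ.fst.map fun a => (a, a)) := mutualInfo_parallelComp_le _ _ _
    _ = ENNReal.ofReal (entropy μ.fst) := by
        rw [mutualInfo_eq_ofReal_entropy, hent, Measure.fst_map_prodMk (by fun_prop),
          Measure.snd_map_prodMk (by fun_prop)]
        simp

/-! ### Events and the `ℓ¹` distance -/

theorem measureReal_sub_le_l1Dist {A : Type*} [MeasurableSpace A] (μ ν : Measure A)
    [IsFiniteMeasure μ] [IsFiniteMeasure ν] {s : Set A} (hs : MeasurableSet s) :
    μ.real s - ν.real s ≤ l1Dist μ ν := by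
  rw [← Measure.toSignedMeasure_sub_apply hs,
    SignedMeasure.apply_eq_posPart_real_sub_negPart_real _ hs, l1Dist]
  set j := (μ.toSignedMeasure - ν.toSignedMeasure).toJordanDecomposition
  have h1 : j.posPart.real s ≤ j.posPart.real Set.univ := measureReal_mono (Set.subset_univ s)
  have h2 : (SignedMeasure.totalVariation (μ.toSignedMeasure - ν.toSignedMeasure)).real Set.univ
      = j.posPart.real Set.univ + j.negPart.real Set.univ := by
    rw [SignedMeasure.totalVariation, measureReal_add_apply]
  rw [h2]
  linarith [measureReal_nonneg (μ := j.negPart) (s := s),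
    measureReal_nonneg (μ := j.negPart) (s := Set.univ)]

/-! ### A Fano-type inequality -/

/-- A Fano-type inequality: if the joint law `r` of a pair is concentrated, up to mass `c`, on the
graph of a bijection `e`, then the conditional entropy of the first variable given the second is at
most `c log |A| - c log c + c`. This is Gibbs' inequality for `r` against the weights
`w a b * R b`, where `R` is the second marginal and `w` is `1` on the graph and `c / |A|` off it;
the weights have total mass at most `1 + c`. Leaving them unnormalized costs the term `c`, but makes
the case `c = 0` no exception. -/
theorem sum_negMulLog_sub_le {A B : Type*} [Fintype A] [Fintype B] [DecidableEq B]
    (r : A → B → ℝ) (hr : ∀ a b, 0 ≤ r a b) (hsum : ∑ a, ∑ b, r a b = 1) (e : A ≃ B)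
    {c : ℝ} (hc0 : 0 ≤ c) (hc1 : c ≤ 1)
    (hoff : ∑ a, ∑ b, (if b = e a then 0 else r a b) ≤ c) :
    ∑ a, ∑ b, Real.negMulLog (r a b) - ∑ b, Real.negMulLog (∑ a, r a b)
      ≤ c * Real.log (Fintype.card A) - c * Real.log c + c := by
  set n : ℝ := (Fintype.card A : ℝ) with hn
  have hAne : Nonempty A := by
    by_contra h
    rw [not_nonempty_iff] at h
    simp at hsum
  have hn0 : 0 < n := by rw [hn]; exact_mod_cast Fintype.card_pos
  set R : B → ℝ := fun b => ∑ a, r a b with hR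
  set w : A → B → ℝ := fun a b => if b = e a then 1 else c / n with hw
  have hw0 (a : A) (b : B) : 0 ≤ w a b := by simp only [hw]; split_ifs <;> positivity
  have hterm (a : A) (b : B) : Real.negMulLog (r a b) + r a b * Real.log (R b)
      ≤ w a b * R b - r a b - r a b * Real.log (w a b) := by
    have hle : r a b ≤ R b :=
      Finset.single_le_sum (f := fun a => r a b) (fun a _ => hr a b) (Finset.mem_univ a)
    rcases (hr a b).eq_or_lt with h0 | h0
    · simp only [← h0] at hle ⊢
      simpa using mul_nonneg (hw0 a b) hle
    have hwpos : 0 < w a b := by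
      simp only [hw]
      split_ifs with hb
      · exact one_pos
      -- an off-diagonal entry is at most `c`, so a positive one forces `c` to be positive
      · have h1 : r a b ≤ ∑ a, ∑ b, (if b = e a then 0 else r a b) := by
          have hnn (a : A) (b : B) : 0 ≤ (if b = e a then 0 else r a b) := by
            split_ifs
            exacts [le_rfl, hr a b]
          calc r a b = (if b = e a then 0 else r a b) := (if_neg hb).symm
            _ ≤ ∑ b, (if b = e a then 0 else r a b) :=
              Finset.single_le_sum (f := fun b => if b = e a then 0 else r a b)
                (fun b _ => hnn a b) (Finset.mem_univ b)
            _ ≤ _ := Finset.single_le_sum (f := fun a => ∑ b, if b = e a then 0 else r a b)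
                (fun a _ => Finset.sum_nonneg fun b _ => hnn a b) (Finset.mem_univ a)
        exact div_pos (h0.trans_le (h1.trans hoff)) hn0
    have hRpos : 0 < R b := h0.trans_le hle
    have hlog := Real.log_le_sub_one_of_pos (x := w a b * R b / r a b) (by positivity)
    rw [Real.log_div (by positivity) h0.ne', Real.log_mul hwpos.ne' hRpos.ne'] at hlog
    have := mul_le_mul_of_nonneg_left hlog h0.le
    rw [mul_sub, mul_sub, mul_add, mul_div_cancel₀ _ h0.ne'] at this
    rw [Real.negMulLog]
    linarith
  have hlhs : ∑ a, ∑ b, Real.negMulLog (r a b) - ∑ b, Real.negMulLog (R b)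
      = ∑ a, ∑ b, (Real.negMulLog (r a b) + r a b * Real.log (R b)) := by
    have : ∑ a, ∑ b, r a b * Real.log (R b) = - ∑ b, Real.negMulLog (R b) := by
      rw [Finset.sum_comm]
      simp only [Real.negMulLog, neg_mul, Finset.sum_neg_distrib, neg_neg, ← Finset.sum_mul, hR]
    simp only [Finset.sum_add_distrib, this]
    ring
  have hwR : ∑ a, ∑ b, w a b * R b ≤ 1 + c := by
    have hcol (b : B) : ∑ a, w a b ≤ 1 + c := by
      classical
      calc ∑ a, w a b ≤ ∑ a, ((if a = e.symm b then 1 else 0) + c / n) := by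
            refine Finset.sum_le_sum fun a _ => ?_
            have : 0 ≤ c / n := by positivity
            by_cases hb : b = e a
            · simp [hw, hb, this]
            · have : a ≠ e.symm b := fun h => hb (by simp [h])
              simp [hw, hb, this]
        _ = 1 + c := by
            simp only [Finset.sum_add_distrib, Finset.sum_ite_eq', Finset.mem_univ, if_true,
              Finset.sum_const, Finset.card_univ, nsmul_eq_mul, ← hn]
            rw [mul_div_cancel₀ _ hn0.ne']
    have hRsum : ∑ b, R b = 1 := by rw [← hsum, Finset.sum_comm]
    rw [Finset.sum_comm]
    calc ∑ b, ∑ a, w a b * R b = ∑ b, (∑ a, w a b) * R b := by simp only [Finset.sum_mul]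
      _ ≤ ∑ b, (1 + c) * R b := Finset.sum_le_sum fun b _ =>
          mul_le_mul_of_nonneg_right (hcol b) (Finset.sum_nonneg fun a _ => hr a b)
      _ = 1 + c := by rw [← Finset.mul_sum, hRsum, mul_one]
  have hlogw : ∑ a, ∑ b, r a b * Real.log (w a b)
      = (∑ a, ∑ b, (if b = e a then 0 else r a b)) * Real.log (c / n) := by
    simp only [Finset.sum_mul]
    refine Finset.sum_congr rfl fun a _ => Finset.sum_congr rfl fun b _ => ?_
    simp only [hw]
    split_ifs <;> simp
  have hmass : c * Real.log (c / n)
      ≤ (∑ a, ∑ b, (if b = e a then 0 else r a b)) * Real.log (c / n) := by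
    refine mul_le_mul_of_nonpos_right hoff (Real.log_nonpos (by positivity) ?_)
    have : (1 : ℝ) ≤ n := by rw [hn]; exact_mod_cast Fintype.card_pos
    exact (div_le_one hn0).2 (hc1.trans this)
  have hlogc : c * Real.log (c / n) = c * Real.log c - c * Real.log n := by
    rcases hc0.eq_or_lt with rfl | h
    · simp
    · rw [Real.log_div h.ne' hn0.ne', mul_sub]
  rw [hlhs]
  calc _ ≤ ∑ a, ∑ b, (w a b * R b - r a b - r a b * Real.log (w a b)) :=
        Finset.sum_le_sum fun a _ => Finset.sum_le_sum fun b _ => hterm a b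
    _ = ∑ a, ∑ b, w a b * R b - 1 - ∑ a, ∑ b, r a b * Real.log (w a b) := by
        simp only [Finset.sum_sub_distrib, hsum]
    _ ≤ _ := by rw [hlogw]; linarith

theorem le_gammaBound {c : ℝ} (hc0 : 0 ≤ c) (hc : c ≤ 1 / 2) (n : ℕ) :
    c * Real.log n - c * Real.log c + c ≤ gammaBound c n := by
  have hn : 0 ≤ c * Real.log n := mul_nonneg hc0 (Real.log_natCast_nonneg n)
  rcases hc0.eq_or_lt with rfl | h
  · simp [gammaBound]
  have hlog : Real.log c ≤ - Real.log 2 := by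
    rw [← Real.log_inv]
    exact Real.log_le_log h (by linarith)
  have h2 := Real.log_two_gt_d9
  have : c * 1 ≤ c * (-2 * Real.log c) := mul_le_mul_of_nonneg_left (by linarith) hc0
  rw [gammaBound]
  linarith

section Fano
variable {A B : Type*} [Fintype A] [Fintype B] [MeasurableSpace A] [MeasurableSpace B]
  [MeasurableSingletonClass A] [MeasurableSingletonClass B]

/-- Both conditional entropies of a pair that is concentrated, up to mass `c`, on the graph of a
bijection. -/
theorem entropy_sub_entropy_le (μ : Measure (A × B)) [IsProbabilityMeasure μ] (e : A ≃ B)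
    {c : ℝ} (hc0 : 0 ≤ c) (hc1 : c ≤ 1) (hoff : μ.real {z | z.2 ≠ e z.1} ≤ c) :
    entropy μ - entropy μ.snd ≤ c * Real.log (Fintype.card A) - c * Real.log c + c ∧
    entropy μ - entropy μ.fst ≤ c * Real.log (Fintype.card A) - c * Real.log c + c := by
  classical
  have hsum : ∑ a, ∑ b, μ.real {(a, b)} = 1 := by
    simp only [← fst_real_singleton]
    rw [sum_measureReal_singleton]
    simp
  have hoff' : ∑ a, ∑ b, (if b = e a then 0 else μ.real {(a, b)}) ≤ c := by
    refine le_of_eq_of_le ?_ hoff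
    rw [← Fintype.sum_prod_type' (f := fun a b => if b = e a then 0 else μ.real {(a, b)})]
    have : {z : A × B | z.2 ≠ e z.1} = ((Finset.univ.filter fun z : A × B => z.2 ≠ e z.1) :
        Finset (A × B)) := by ext; simp
    rw [this, ← sum_measureReal_singleton, Finset.sum_filter]
    refine Finset.sum_congr rfl fun z _ => ?_
    by_cases h : z.2 = e z.1 <;> simp [h]
  have hent : entropy μ = ∑ a, ∑ b, Real.negMulLog (μ.real {(a, b)}) := by
    rw [entropy, Fintype.sum_prod_type]
  constructor
  · have := sum_negMulLog_sub_le (fun a b => μ.real {(a, b)}) (fun _ _ => measureReal_nonneg)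
      hsum e hc0 hc1 hoff'
    rw [hent, entropy]
    simpa only [snd_real_singleton] using this
  · have := sum_negMulLog_sub_le (fun b a => μ.real {(a, b)}) (fun _ _ => measureReal_nonneg)
      (by rw [Finset.sum_comm]; exact hsum) e.symm hc0 hc1 (by
        rw [Finset.sum_comm]
        simpa only [Equiv.eq_symm_apply, eq_comm] using hoff')
    rw [← Fintype.card_congr e, Finset.sum_comm] at this
    rw [hent, entropy]
    simpa only [fst_real_singleton] using this

end Fano

/-! ### Bottleneck variables -/

section Bottleneck
variable {X Y T : Type*} [MeasurableSpace X] [MeasurableSpace Y] [MeasurableSpace T]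

instance (p : Measure (X × Y)) [IsProbabilityMeasure p] (q : Kernel X T) [IsMarkovKernel q] :
    IsProbabilityMeasure (jointXYT p q) := by
  unfold jointXYT; infer_instance

theorem jointXYT_map_fst_snd (p : Measure (X × Y)) [IsProbabilityMeasure p] (q : Kernel X T)
    [IsMarkovKernel q] : (jointXYT p q).map (fun z => (z.1.1, z.2)) = p.fst ⊗ₘ q := by
  ext s hs
  have hg : Measurable fun z : (X × Y) × T => (z.1.1, z.2) := by fun_prop
  rw [Measure.map_apply hg hs, jointXYT, Measure.compProd_apply (hg hs),
    Measure.compProd_apply hs, Measure.fst,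
    lintegral_map (Kernel.measurable_kernel_prodMk_left hs) measurable_fst]
  rfl

/-- By the Markov condition `Y - X - T`, the law of `(Y, T)` arises from that of `(X, T)` by applying
the conditional law of `Y` given `X` to the first variable. -/
theorem jointXYT_map_snd_snd (p : Measure (X × Y)) [IsProbabilityMeasure p] (q : Kernel X T)
    [IsMarkovKernel q] (κ : Kernel X Y) [IsMarkovKernel κ] (hκ : p.fst ⊗ₘ κ = p) :
    (jointXYT p q).map (fun z => (z.1.2, z.2)) = (κ ∥ₖ Kernel.id) ∘ₘ (p.fst ⊗ₘ q) := by
  rw [Measure.compProd_eq_comp_prod, Measure.comp_assoc, Kernel.parallelComp_comp_prod,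
    Kernel.comp_id, Kernel.id_comp]
  ext s hs
  have hg : Measurable fun z : (X × Y) × T => (z.1.2, z.2) := by fun_prop
  rw [Measure.map_apply hg hs, jointXYT, Measure.compProd_apply (hg hs),
    Measure.bind_apply hs (Kernel.aemeasurable _)]
  conv_lhs => rw [← hκ]
  rw [Measure.lintegral_compProd (Kernel.measurable_kernel_prodMk_left (hg hs))]
  refine lintegral_congr fun x => ?_
  rw [Kernel.prod_apply, Measure.prod_apply hs]
  rfl

theorem infoY_le_infoX [Finite Y] [MeasurableSingletonClass Y] (p : Measure (X × Y))
    [IsProbabilityMeasure p] (q : Kernel X T) [IsMarkovKernel q] : infoY p q ≤ infoX p q := by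
  have : Nonempty Y := by
    obtain ⟨z⟩ := nonempty_of_isProbabilityMeasure p
    exact ⟨z.2⟩
  rw [infoX, infoY, jointXYT_map_fst_snd,
    jointXYT_map_snd_snd p q p.condKernel (p.disintegrate p.condKernel)]
  exact mutualInfo_parallelComp_le _ _ _

theorem infoY_le_entropy [Fintype Y] [MeasurableSingletonClass Y] (p : Measure (X × Y))
    [IsProbabilityMeasure p] (q : Kernel X T) [IsMarkovKernel q] :
    infoY p q ≤ ENNReal.ofReal (entropy p.snd) := by
  have hg : Measurable fun z : (X × Y) × T => (z.1.2, z.2) := by fun_prop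
  have := Measure.isProbabilityMeasure_map (μ := jointXYT p q) hg.aemeasurable
  have hfst : ((jointXYT p q).map (fun z => (z.1.2, z.2))).fst = p.snd := by
    have h : (jointXYT p q).fst = p := Measure.fst_compProd _ _
    calc ((jointXYT p q).map (fun z => (z.1.2, z.2))).fst
        = (jointXYT p q).map (fun z => z.1.2) := Measure.fst_map_prodMk (by fun_prop)
      _ = (jointXYT p q).fst.snd := (Measure.map_map measurable_snd measurable_fst).symm
      _ = p.snd := by rw [h]
  rw [← hfst]
  exact mutualInfo_le_entropy_fst _

theorem jointXYT_deterministic (p : Measure (X × Y)) [IsProbabilityMeasure p] {g : X → T}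
    (hg : Measurable g) :
    jointXYT p (Kernel.deterministic g hg) = p.map (fun z => (z, g z.1)) := by
  have : (Kernel.deterministic g hg).comap (Prod.fst : X × Y → X) measurable_fst
      = Kernel.deterministic (fun z : X × Y => g z.1) (by fun_prop) := by
    ext z; simp [Kernel.comap_apply, Kernel.deterministic_apply]
  rw [jointXYT, this, Measure.compProd_deterministic]

theorem infoX_deterministic_le_entropy [Fintype T] [MeasurableSingletonClass T]
    (p : Measure (X × Y)) [IsProbabilityMeasure p] {g : X → T} (hg : Measurable g) :
    infoX p (Kernel.deterministic g hg)
      ≤ ENNReal.ofReal (entropy (p.map fun z => g z.1)) := by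
  have hs : infoX p (Kernel.deterministic g hg)
      = mutualInfo ((p.map fun z => (g z.1, z.1)).map Prod.swap) := by
    rw [infoX, jointXYT_deterministic, Measure.map_map (by fun_prop) (by fun_prop),
      Measure.map_map (by fun_prop) (by fun_prop)]
    rfl
  have := Measure.isProbabilityMeasure_map (μ := p) (f := fun z => (g z.1, z.1)) (by fun_prop)
  refine hs.trans_le ((mutualInfo_map_swap_le _).trans ((mutualInfo_le_entropy_fst _).trans_eq ?_))
  rw [Measure.fst_map_prodMk (by fun_prop)]

theorem infoY_deterministic_eq [Fintype Y] [MeasurableSingletonClass Y]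
    [Fintype T] [MeasurableSingletonClass T]
    (p : Measure (X × Y)) [IsProbabilityMeasure p] {g : X → T} (hg : Measurable g) :
    infoY p (Kernel.deterministic g hg)
      = ENNReal.ofReal (entropy p.snd + entropy (p.map fun z => g z.1)
        - entropy (p.map fun z => (z.2, g z.1))) := by
  have := Measure.isProbabilityMeasure_map (μ := p) (f := fun z => (z.2, g z.1)) (by fun_prop)
  have hs : (jointXYT p (Kernel.deterministic g hg)).map (fun z => (z.1.2, z.2))
      = p.map fun z => (z.2, g z.1) := by
    rw [jointXYT_deterministic, Measure.map_map (by fun_prop) (by fun_prop)]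
    rfl
  rw [infoY, hs, mutualInfo_eq_ofReal_entropy, Measure.fst_map_prodMk (by fun_prop),
    Measure.snd_map_prodMk (by fun_prop)]
  rfl

/-- The Lagrangian of the bottleneck variable `f(X)`, relabelled by a bijection `e`, when `Y = f(X)`
outside an event of mass at most `c`. The relabelling lets this variable take values in a type of any
universe. -/
theorem le_lagrangian_deterministic [Fintype Y] [MeasurableSingletonClass Y]
    [Fintype T] [MeasurableSingletonClass T] (p : Measure (X × Y)) [IsProbabilityMeasure p]
    {f : X → Y} (hf : Measurable f) (e : Y ≃ T) {c β : ℝ} (hc : c ≤ 1 / 2)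
    (hβ0 : 0 ≤ β) (hβ1 : β ≤ 1) (hoff : p.real {z | z.2 ≠ f z.1} ≤ c) :
    (((1 - β) * entropy p.snd - gammaBound c (Fintype.card Y) : ℝ) : EReal)
      ≤ lagrangian p β (Kernel.deterministic (fun x => e (f x))
          ((measurable_of_finite e).comp hf)) := by
  have hg : Measurable fun x => e (f x) := (measurable_of_finite e).comp hf
  have hpair : Measurable fun z : X × Y => (z.2, e (f z.1)) := by fun_prop
  have hc0 : 0 ≤ c := measureReal_nonneg.trans hoff
  have := Measure.isProbabilityMeasure_map (μ := p) hpair.aemeasurable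
  have := Measure.isProbabilityMeasure_map (μ := p) (f := fun z => e (f z.1)) (by fun_prop)
  obtain ⟨h1, h2⟩ := entropy_sub_entropy_le (p.map fun z => (z.2, e (f z.1))) e hc0
    (hc.trans (by norm_num)) (by
      rw [map_measureReal_apply hpair (Set.toFinite _).measurableSet]
      refine le_of_eq_of_le ?_ hoff
      congr 1
      ext z
      simp [eq_comm])
  rw [Measure.snd_map_prodMk (by fun_prop)] at h1
  rw [Measure.fst_map_prodMk (by fun_prop), ← Measure.snd] at h2
  have hγ := le_gammaBound hc0 hc (Fintype.card Y)
  have hX := infoX_deterministic_le_entropy p hg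
  have hY := infoY_deterministic_eq p hg
  have hH := entropy_nonneg (p.map fun z => e (f z.1))
  set HYT := entropy (p.map fun z => (z.2, e (f z.1)))
  set HT := entropy (p.map fun z => e (f z.1))
  set HY := entropy p.snd
  rw [lagrangian, hY]
  have hX' : (infoX p (Kernel.deterministic _ hg)).toReal ≤ HT :=
    ENNReal.toReal_le_of_le_ofReal hH hX
  have hXe : (infoX p (Kernel.deterministic _ hg) : EReal)
      = ((infoX p (Kernel.deterministic _ hg)).toReal : EReal) :=
    (EReal.coe_ennreal_toReal (ne_top_of_le_ne_top ENNReal.ofReal_ne_top hX)).symm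
  rw [hXe, EReal.coe_ennreal_ofReal]
  norm_cast
  have := mul_le_mul_of_nonneg_left hX' hβ0
  have := mul_le_mul_of_nonneg_left (h1.trans hγ) (sub_nonneg.2 hβ1)
  have := mul_le_mul_of_nonneg_left (h2.trans hγ) hβ0
  have := le_max_left (HY + HT - HYT) 0
  linarith

end Bottleneck
end InfoBottleneck

theorem theorem4 {X Y T : Type*} [MeasurableSpace X]
    [Fintype Y] [MeasurableSpace Y] [MeasurableSingletonClass Y] [MeasurableSpace T]
    (p p' : Measure (X × Y)) [IsProbabilityMeasure p] [IsProbabilityMeasure p']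
    (f : X → Y) (hf : Measurable f) (hdet : ∀ᵐ z ∂p', z.2 = f z.1)
    (hmarg : p.fst = p'.fst)
    (ε : ℝ) (hdist : InfoBottleneck.l1Dist p p' ≤ ε) (hε : ε ≤ 1 / 2)
    (β : ℝ) (hβ0 : 0 < β) (hβ1 : β < 1)
    (q : Kernel X T) [IsMarkovKernel q]
    (hmax : InfoBottleneck.IsLagrangianMaximizer p β q) :
    (((-(InfoBottleneck.gammaBound ε (Fintype.card Y) / (1 - β)) : ℝ) : EReal)
        ≤ (InfoBottleneck.infoX p q : EReal) - (InfoBottleneck.entropy p.snd : EReal)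
      ∧ (InfoBottleneck.infoX p q : EReal) - (InfoBottleneck.entropy p.snd : EReal)
        ≤ ((InfoBottleneck.gammaBound ε (Fintype.card Y) / β : ℝ) : EReal))
    ∧ (((-(InfoBottleneck.gammaBound ε (Fintype.card Y) / (1 - β)) : ℝ) : EReal)
        ≤ (InfoBottleneck.infoY p q : EReal) - (InfoBottleneck.entropy p.snd : EReal)
      ∧ (InfoBottleneck.infoY p q : EReal) - (InfoBottleneck.entropy p.snd : EReal) ≤ 0) := by
  open InfoBottleneck in
  have hE : MeasurableSet {z : X × Y | z.2 ≠ f z.1} :=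
    (measurableSet_eq_fun measurable_snd (hf.comp measurable_fst)).compl
  have hoff : p.real {z | z.2 ≠ f z.1} ≤ ε := by
    have h := measureReal_sub_le_l1Dist p p' hE
    have h0 : p'.real {z | z.2 ≠ f z.1} = 0 := by
      rw [measureReal_def, ae_iff.1 hdet, ENNReal.toReal_zero]
    linarith
  -- competitors must live in the universe of `T`, so the outcomes of `Y` are lifted to it
  let e : Y ≃ ULift (Fin (Fintype.card Y)) := (Fintype.equivFin Y).trans Equiv.ulift.symm
  let : MeasurableSpace (ULift (Fin (Fintype.card Y))) := ⊤
  have hlow := (le_lagrangian_deterministic p hf e hε hβ0.le hβ1.le hoff).trans (hmax _ _)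
  have hYX := infoY_le_infoX p q
  have hYH := infoY_le_entropy p q
  have hH := entropy_nonneg p.snd
  have hYtop : infoY p q ≠ ⊤ := ne_top_of_le_ne_top ENNReal.ofReal_ne_top hYH
  -- an infinite `I(X;T)` would make the Lagrangian `-∞`
  have hXtop : infoX p q ≠ ⊤ := by
    intro h
    rw [lagrangian, h, EReal.coe_ennreal_top, EReal.coe_mul_top_of_pos hβ0, EReal.sub_top] at hlow
    exact EReal.coe_ne_bot _ (le_bot_iff.1 hlow)
  have h1 : (infoY p q).toReal ≤ (infoX p q).toReal := ENNReal.toReal_mono hXtop hYX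
  have h2 : (infoY p q).toReal ≤ entropy p.snd := ENNReal.toReal_le_of_le_ofReal hH hYH
  rw [lagrangian, ← EReal.coe_ennreal_toReal hXtop, ← EReal.coe_ennreal_toReal hYtop] at hlow
  rw [← EReal.coe_ennreal_toReal hXtop, ← EReal.coe_ennreal_toReal hYtop]
  norm_cast at hlow ⊢
  have hβ1' : 0 < 1 - β := by linarith
  have hmul := mul_le_mul_of_nonneg_left h1 hβ0.le
  have hX : -(gammaBound ε (Fintype.card Y) / (1 - β)) ≤ (infoY p q).toReal - entropy p.snd := by
    rw [← neg_div, div_le_iff₀ hβ1']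
    linarith
  refine ⟨⟨by linarith, ?_⟩, hX, by linarith⟩
  rw [le_div_iff₀ hβ0]
  linarith
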